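/- Let $A$ be a finite alphabet with $|A|\ge 2$, and let $A^*$ be the free monoid on $A$. The density of a language $L\subseteq A^*$ is $$\delta_A(L)=\lim_{m\to\infty}\frac1m\sum_{k=0}^{m-1}\frac{|L\cap A^k|}{|A^k|},$$ whenever this limit exists. For a family $\mathcal C$ of languages over $A$, a language $L$ is called $\mathcal C$-measurable if $$\sup\{\delta_A(K): K\in\mathcal C,\ K\subseteq L,\ \delta_A(K)\text{ exists}\}=\inf\{\delta_A(K): K\in\mathcal C,\ L\subseteq K,\ \delta_A(K)\text{ exists}\},$$ and $\mathrm{RExt}(\mathcal C)$ denotes the class of all $\mathcal C$-measurable regular languages over $A$. A monoid $M$ recognises $L$ if $L=\eta^{-1}(S)$ for some monoid morphism $\eta\colon A^*\to M$ and some $S\subseteq M$. Let $\mathsf G_A$ be the class of all languages over $A$ recognised by a finite group and, for $n\ge1$, let $\mathsf{Gnil}_A^{\le n}$ (respectively $\mathsf{Gsol}_A^{\le n}$) be the class of all languages over $A$ recognised by a finite nilpotent group of class at most $n$ (respectively by a finite solvable group of derived length at most $n$). Then, for every integer $n\ge 1$, - $\mathrm{RExt}(\mathsf{Gnil}_A^{\le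 n})\subsetneq\mathrm{RExt}(\mathsf{Gnil}_A^{\le n+1})\subsetneq\mathrm{RExt}(\mathsf G_A)$, and - $\mathrm{RExt}(\mathsf{Gsol}_A^{\le n})\subsetneq\mathrm{RExt}(\mathsf{Gsol}_A^{\le n+1})\subsetneq\mathrm{RExt}(\mathsf G_A)$. -/

import Mathlib

open Filter Topology

namespace LangMeasure

/-- `HasDensity L d`: the limit
`lim_{n → ∞} (1 / n) * ∑_{k < n} |L ∩ A^k| / |A^k|` exists and is equal to `d`. -/
def HasDensity {A : Type*} [Fintype A] (L : Language A) (d : ℝ) : Prop :=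
  Tendsto (fun n : ℕ => (1 / (n : ℝ)) * ∑ k ∈ Finset.range n,
      ({w : List A | w ∈ L ∧ w.length = k}.ncard : ℝ) / ((Fintype.card A : ℝ) ^ k))
    atTop (𝓝 d)

/-- The `C`-inner-density of `L`: the supremum of the densities of the members of `C` that are
contained in `L` and have a density. It is taken in the extended reals, so that the supremum over
an empty family is `-∞`. -/
noncomputable def innerDensity {A : Type*} [Fintype A] (C : Set (Language A)) (L : Language A) :
    EReal :=
  sSup {x : EReal | ∃ K ∈ C, (∀ w ∈ K, w ∈ L) ∧ ∃ d : ℝ, HasDensity K d ∧ x = (d : EReal)}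

/-- The `C`-outer-density of `L`: the infimum of the densities of the members of `C` that
contain `L` and have a density. It is taken in the extended reals, so that the infimum over
an empty family is `+∞`. -/
noncomputable def outerDensity {A : Type*} [Fintype A] (C : Set (Language A)) (L : Language A) :
    EReal :=
  sInf {x : EReal | ∃ K ∈ C, (∀ w ∈ L, w ∈ K) ∧ ∃ d : ℝ, HasDensity K d ∧ x = (d : EReal)}

/-- `L` is `C`-measurable if its `C`-inner-density and its `C`-outer-density coincide. -/
def MeasurableBy {A : Type*} [Fintype A] (C : Set (Language A)) (L : Language A) : Prop :=
  innerDensity C L = outerDensity C L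

/-- `RExt C` is the class of all `C`-measurable regular languages. -/
def RExt {A : Type*} [Fintype A] (C : Set (Language A)) : Set (Language A) :=
  {L | L.IsRegular ∧ MeasurableBy C L}

/-- The monoid `M` recognises `L`: there are a monoid morphism `η : A^* → M` and a subset `S` of
`M` with `L = η⁻¹(S)`. -/
def Recognises {A : Type*} (M : Type*) [Monoid M] (L : Language A) : Prop :=
  ∃ (η : FreeMonoid A →* M) (S : Set M), ∀ w : List A, w ∈ L ↔ η (FreeMonoid.ofList w) ∈ S

/-- The derived length of a solvable group: the least `k` such that the `k`-th term of the derived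
series is trivial. (It is only meaningful for solvable groups.) -/
noncomputable def derivedLength (G : Type*) [Group G] : ℕ :=
  sInf {k : ℕ | derivedSeries G k = ⊥}

/-- The group languages over `A`: the languages recognised by a finite group. (Every finite group
has an isomorphic copy in `Type`.) -/
def GroupLang (A : Type*) : Set (Language A) :=
  {L | ∃ (G : Type) (_ : Group G), Finite G ∧ Recognises G L}

/-- The languages over `A` recognised by a finite nilpotent group of class at most `n`. -/
def GnilLE (A : Type*) (n : ℕ) : Set (Language A) :=
  {L | ∃ (G : Type) (_ : Group G), Finite G ∧
    (Group.IsNilpotent G ∧ Group.nilpotencyClass G ≤ n) ∧ Recognises G L}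

/-- The languages over `A` recognised by a finite solvable group of derived length at most `n`. -/
def GsolLE (A : Type*) (n : ℕ) : Set (Language A) :=
  {L | ∃ (G : Type) (_ : Group G), Finite G ∧
    (Group.IsSolvable G ∧ derivedLength G ≤ n) ∧ Recognises G L}

end LangMeasure

/-!
The two chains are strict because of the languages `{w | η w = 1}` of morphisms `η` from `A^*` to
finite groups `G` (`kernelLanguage`).

Such a language has a positive density: the proportion of words of length `k` that are trivial
in `G` is a return probability of a random walk on `G`, and the mean ergodic theorem gives the
convergence of the averages (`exists_hasDensity_kernelLanguage`). So it is measurable by every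
class to which it belongs. On the other hand, suppose that some element `x` of the free group on `A`
is nontrivial in `G` but trivial in all the groups recognising the members of a class `C`. Words act
on finite groups like free group elements, so a nonempty member of `C` always contains a word that
is nontrivial in `G`. Hence the language has inner density at most `0` and positive outer density
with respect to `C`, and is not `C`-measurable (`RExt_ssubset_of_separating`).

For groups of nilpotency class (derived length) at most `n`, the element `x` is taken in the `n`-th
term of the lower central (derived) series of the free group; both series are indexed from `0`.
What remains is a finite group `G` of class (derived length) at most `n + 1` in which some such `x`
is nontrivial. The Sanov matrices `[1, 2; 0, 1]` and `[1, 0; 2, 1]` generate a subgroup of `SL₂(ℤ)`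
that maps onto the perfect group `SL₂(𝔽₅)`, so all terms of its derived series are nontrivial; its
reductions modulo powers of `2` are finite `2`-groups, and they separate its elements
(`exists_isPGroup_two_derivedSeries_ne_bot`). A quotient of one of these `2`-groups by a term of its
lower central or derived series is the required `G`.

The inclusion of `RExt` at level `n + 1` in `RExt (GroupLang A)` is strict because it passes through
level `n + 2`.
-/

namespace LangMeasure

/-! ### Measurability of languages -/

section Measurability

variable {A : Type*} [Fintype A]

theorem HasDensity.mono {K L : Language A} {d e : ℝ} (hK : HasDensity K d) (hL : HasDensity L e)
    (h : ∀ w ∈ K, w ∈ L) : d ≤ e := by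
  refine le_of_tendsto_of_tendsto' hK hL fun n => ?_
  gcongr
  · exact (List.finite_length_eq A _).subset fun w hw => hw.2
  · exact fun hw => h _ hw

theorem innerDensity_le_outerDensity (C : Set (Language A)) (L : Language A) :
    innerDensity C L ≤ outerDensity C L := by
  refine sSup_le ?_
  rintro _ ⟨K, -, hKL, d, hd, rfl⟩
  refine le_sInf ?_
  rintro _ ⟨K', -, hLK, e, he, rfl⟩
  exact EReal.coe_le_coe_iff.2 (hd.mono he fun w hw => hLK w (hKL w hw))

theorem RExt_mono {C D : Set (Language A)} (h : C ⊆ D) : RExt C ⊆ RExt D := by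
  rintro L ⟨hr, hm⟩
  refine ⟨hr, le_antisymm (innerDensity_le_outerDensity D L) ?_⟩
  calc outerDensity D L ≤ outerDensity C L :=
        sInf_le_sInf fun x ⟨K, hK, h'⟩ => ⟨K, h hK, h'⟩
    _ = innerDensity C L := hm.symm
    _ ≤ innerDensity D L := sSup_le_sSup fun x ⟨K, hK, h'⟩ => ⟨K, h hK, h'⟩

theorem measurableBy_of_mem {C : Set (Language A)} {L : Language A} {d : ℝ} (hL : L ∈ C)
    (hd : HasDensity L d) : MeasurableBy C L :=
  le_antisymm (innerDensity_le_outerDensity C L)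
    ((sInf_le ⟨L, hL, fun _ h => h, d, hd, rfl⟩ : outerDensity C L ≤ d).trans
      (le_sSup ⟨L, hL, fun _ h => h, d, hd, rfl⟩))

theorem hasDensity_of_forall_notMem {L : Language A} (h : ∀ w, w ∉ L) : HasDensity L 0 := by
  simp [HasDensity, h]

/-- A language of positive density containing no nonempty member of `C` is not `C`-measurable:
its inner density is at most `0`, its outer density at least its density. -/
theorem not_measurableBy_of_pos {C : Set (Language A)} {L : Language A} {d : ℝ} (hd : HasDensity L d)
    (hpos : 0 < d) (hC : ∀ K ∈ C, (∀ w ∈ K, w ∈ L) → ∀ w, w ∉ K) : ¬ MeasurableBy C L := by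
  intro h
  have h1 : innerDensity C L ≤ (0 : ℝ) := by
    refine sSup_le ?_
    rintro _ ⟨K, hK, hKL, e, he, rfl⟩
    rw [tendsto_nhds_unique he (hasDensity_of_forall_notMem (hC K hK hKL))]
  have h2 : (d : EReal) ≤ outerDensity C L := by
    refine le_sInf ?_
    rintro _ ⟨K, -, hLK, e, he, rfl⟩
    exact EReal.coe_le_coe_iff.2 (hd.mono he hLK)
  rw [← h] at h2
  exact absurd (EReal.coe_le_coe_iff.1 (h2.trans h1)) (not_le.2 hpos)

end Measurability

/-! ### The density of the kernel language of a morphism to a finite group -/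

section KernelLanguage

variable {A : Type*} {G : Type*} [Group G]

/-- The language of the words that a morphism `η` to a group maps to `1`. -/
def kernelLanguage (η : FreeMonoid A →* G) : Language A :=
  {w : List A | η (FreeMonoid.ofList w) = 1}

theorem mem_kernelLanguage {η : FreeMonoid A →* G} {w : List A} :
    w ∈ kernelLanguage η ↔ η (FreeMonoid.ofList w) = 1 := Iff.rfl

theorem recognises_kernelLanguage (η : FreeMonoid A →* G) : Recognises G (kernelLanguage η) :=
  ⟨η, {1}, fun _ => Iff.rfl⟩

theorem isRegular_kernelLanguage [Finite G] (η : FreeMonoid A →* G) :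
    (kernelLanguage η).IsRegular := by
  have := Fintype.ofFinite G
  let M : DFA A G := ⟨fun g a => g * η (FreeMonoid.of a), 1, {1}⟩
  have key : ∀ (w : List A) (g : G), M.evalFrom g w = g * η (FreeMonoid.ofList w) := by
    intro w
    induction w with
    | nil => intro g; simp
    | cons a w ih => intro g; simp [ih, M, FreeMonoid.ofList_cons, mul_assoc]
  refine Language.isRegular_iff.2 ⟨G, this, M, ?_⟩
  ext w
  simp [DFA.mem_accepts, DFA.eval, key, M, mem_kernelLanguage]

variable [Fintype A] [Fintype G]

/-- The Markov operator of the random walk on `G` whose steps are the images of the letters: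
`(walk η f) g` is the mean of `f (g * η a)` over the letters `a`. -/
noncomputable def walk (η : FreeMonoid A →* G) : EuclideanSpace ℝ G →L[ℝ] EuclideanSpace ℝ G :=
  (Fintype.card A : ℝ)⁻¹ • ∑ a : A, (LinearIsometryEquiv.piLpCongrLeft 2 ℝ ℝ
    (Equiv.mulRight (η (FreeMonoid.of a))⁻¹)).toContinuousLinearEquiv.toContinuousLinearMap

theorem walk_apply (η : FreeMonoid A →* G) (f : EuclideanSpace ℝ G) (g : G) :
    walk η f g = (Fintype.card A : ℝ)⁻¹ * ∑ a : A, f (g * η (FreeMonoid.of a)) := by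
  simp [walk, LinearIsometryEquiv.piLpCongrLeft_apply, Equiv.piCongrLeft'_apply]

theorem norm_walk_le (η : FreeMonoid A →* G) : ‖walk η‖ ≤ 1 := by
  refine ContinuousLinearMap.opNorm_le_bound _ zero_le_one fun f => ?_
  have h : ‖∑ a : A, LinearIsometryEquiv.piLpCongrLeft 2 ℝ ℝ
      (Equiv.mulRight (η (FreeMonoid.of a))⁻¹) f‖ ≤ Fintype.card A * ‖f‖ := by
    refine (norm_sum_le _ _).trans ?_
    simp
  have : walk η f = (Fintype.card A : ℝ)⁻¹ • ∑ a : A, LinearIsometryEquiv.piLpCongrLeft 2 ℝ ℝ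
      (Equiv.mulRight (η (FreeMonoid.of a))⁻¹) f := by
    simp [walk]
  rw [this, norm_smul, norm_inv, Real.norm_natCast, one_mul]
  refine inv_mul_le_of_le_mul₀ (by positivity) (norm_nonneg _) h

open Classical in
theorem walk_iterate_single (η : FreeMonoid A →* G) (k : ℕ) (g : G) :
    ((walk η)^[k] (EuclideanSpace.single 1 1)) g =
      ({w : List A | g * η (FreeMonoid.ofList w) = 1 ∧ w.length = k}.ncard : ℝ) /
        (Fintype.card A : ℝ) ^ k := by
  induction k generalizing g with
  | zero =>
    by_cases hg : g = 1
    · have : {w : List A | g * η (FreeMonoid.ofList w) = 1 ∧ w.length = 0} = {[]} := by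
        ext w; constructor
        · rintro ⟨-, h⟩; simpa using h
        · rintro rfl; simp [hg]
      rw [this]; simp [hg]
    · have : {w : List A | g * η (FreeMonoid.ofList w) = 1 ∧ w.length = 0} = ∅ := by
        ext w
        simp only [List.length_eq_zero_iff, Set.mem_ofPred_eq, Set.mem_empty_iff_false, iff_false]
        rintro ⟨h, rfl⟩; simp [hg] at h
      rw [this]; simp [hg]
  | succ k ih =>
    have hcard : {w : List A | g * η (FreeMonoid.ofList w) = 1 ∧ w.length = k + 1}.ncard =
        ∑ a : A, {w : List A | g * η (FreeMonoid.of a) * η (FreeMonoid.ofList w) = 1 ∧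
          w.length = k}.ncard := by
      have e : {w : List A | g * η (FreeMonoid.ofList w) = 1 ∧ w.length = k + 1} ≃
          Σ a : A, {w : List A | g * η (FreeMonoid.of a) * η (FreeMonoid.ofList w) = 1 ∧
            w.length = k} :=
        { toFun := fun w => match w with
            | ⟨[], h⟩ => absurd h.2 (by simp)
            | ⟨a :: w, h⟩ => ⟨a, w, by simpa [FreeMonoid.ofList_cons, mul_assoc] using h.1,
                by simpa using h.2⟩
          invFun := fun x => ⟨x.1 :: x.2.1, by
            simpa [FreeMonoid.ofList_cons, mul_assoc] using x.2.2.1, by simpa using x.2.2.2⟩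
          left_inv := by
            rintro ⟨_ | ⟨a, w⟩, h⟩
            · exact absurd h.2 (by simp)
            · rfl
          right_inv := fun x => rfl }
      have hfin : ∀ a : A, Finite {w : List A | g * η (FreeMonoid.of a) *
          η (FreeMonoid.ofList w) = 1 ∧ w.length = k} := fun a =>
        ((List.finite_length_eq A k).subset fun w hw => hw.2).to_subtype
      rw [← Nat.card_coe_set_eq, Nat.card_congr e, Nat.card_sigma]
      simp [Nat.card_coe_set_eq]
    rw [Function.iterate_succ_apply', walk_apply, hcard]
    simp only [ih]
    rw [← Finset.sum_div, pow_succ]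
    push_cast
    field_simp

/-- The language of the words that are trivial in a finite group has a density, and it is
positive. By the mean ergodic theorem the density is `⟪δ₁, P δ₁⟫ = ‖P δ₁‖ ^ 2` for the orthogonal
projection `P` to the functions fixed by `walk η`; it is not `0` since the constant function `1`
is fixed and is not orthogonal to `δ₁`. -/
theorem exists_hasDensity_kernelLanguage [Nonempty A] (η : FreeMonoid A →* G) :
    ∃ d : ℝ, 0 < d ∧ HasDensity (kernelLanguage η) d := by
  classical
  let δ : EuclideanSpace ℝ G := EuclideanSpace.single 1 1
  let V := (walk η).eqLocus (1 : EuclideanSpace ℝ G →L[ℝ] EuclideanSpace ℝ G)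
  have hlim := (walk η).tendsto_birkhoffAverage_orthogonalProjection (norm_walk_le η) δ
  set p : V := V.orthogonalProjectionOnto δ with hp
  have hinner (u : V) : inner ℝ p u = (u : EuclideanSpace ℝ G) 1 := by
    rw [hp, Submodule.inner_orthogonalProjectionOnto_eq_of_mem_right]
    simp [δ, EuclideanSpace.inner_single_left]
  refine ⟨(p : EuclideanSpace ℝ G) 1, ?_, ?_⟩
  · rw [← hinner, real_inner_self_eq_norm_sq]
    have : p ≠ 0 := by
      intro h0
      let c : V := ⟨WithLp.toLp 2 fun _ => 1, by
        rw [LinearMap.mem_eqLocus]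
        ext g
        simp [walk_apply]⟩
      have := hinner c
      simp [h0, c] at this
    positivity
  · have h1 := ((EuclideanSpace.proj (𝕜 := ℝ) (1 : G)).continuous.tendsto _).comp hlim
    refine h1.congr fun n => ?_
    simp [birkhoffAverage, birkhoffSum, walk_iterate_single, δ, mem_kernelLanguage]
    

end KernelLanguage

/-! ### Two-generated finite `2`-groups of large derived length -/

section Sanov

open Matrix
open scoped commutatorElement

/-- The first Sanov matrix `[1, 2; 0, 1]`. -/
def sanovUpper : SpecialLinearGroup (Fin 2) ℤ := ⟨!![1, 2; 0, 1], by simp⟩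

/-- The second Sanov matrix `[1, 0; 2, 1]`. -/
def sanovLower : SpecialLinearGroup (Fin 2) ℤ := ⟨!![1, 0; 2, 1], by simp⟩

/-- The morphism from the free group to `SL₂(ℤ)` sending the letter `a` to one Sanov matrix and
every other letter to the other one. -/
noncomputable def sanov {A : Type*} (a : A) : FreeGroup A →* SpecialLinearGroup (Fin 2) ℤ :=
  open Classical in FreeGroup.lift fun x => if x = a then sanovUpper else sanovLower

/-- Reduction of `SL₂(ℤ)` modulo `m`. -/
def reduceMod (m : ℕ) :
    SpecialLinearGroup (Fin 2) ℤ →* SpecialLinearGroup (Fin 2) (ZMod m) :=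
  SpecialLinearGroup.map (Int.castRingHom (ZMod m))

theorem reduceMod_eq_one_iff {m : ℕ} {x : SpecialLinearGroup (Fin 2) ℤ} :
    reduceMod m x = 1 ↔ ∃ Y : Matrix (Fin 2) (Fin 2) ℤ, x.1 = 1 + (m : ℤ) • Y := by
  have hentry : reduceMod m x = 1 ↔
      ∀ i j, (m : ℤ) ∣ x.1 i j - (1 : Matrix (Fin 2) (Fin 2) ℤ) i j := by
    have hone (i j : Fin 2) : (1 : Matrix (Fin 2) (Fin 2) (ZMod m)) i j =
        (((1 : Matrix (Fin 2) (Fin 2) ℤ) i j : ℤ) : ZMod m) := by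
      rw [Matrix.one_apply, Matrix.one_apply]
      split_ifs <;> simp
    simp_rw [← ZMod.intCast_zmod_eq_zero_iff_dvd, Int.cast_sub, sub_eq_zero, ← hone]
    exact Matrix.SpecialLinearGroup.ext_iff _ _
  rw [hentry]
  constructor
  · intro h
    choose Y hY using h
    refine ⟨Matrix.of Y, ?_⟩
    rw [← sub_eq_iff_eq_add']
    ext i j
    simp [hY, Matrix.smul_apply]
  · rintro ⟨Y, hY⟩ i j
    rw [hY, Matrix.add_apply, Matrix.smul_apply, add_sub_cancel_left]
    exact ⟨Y i j, rfl⟩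

/-- Both Sanov matrices are trivial modulo `2`. -/
theorem reduceMod_two_sanov {A : Type*} (a : A) (x : FreeGroup A) :
    reduceMod 2 (sanov a x) = 1 := by
  have : (reduceMod 2).comp (sanov a) = 1 := by
    ext1 y
    have hU : reduceMod 2 sanovUpper = 1 := by decide
    have hV : reduceMod 2 sanovLower = 1 := by decide
    simp only [sanov, MonoidHom.comp_apply, FreeGroup.lift_apply_of, MonoidHom.one_apply]
    split_ifs
    exacts [hU, hV]
  exact DFunLike.congr_fun this x

/-- If `x ≡ 1` modulo `2`, then `x ^ 2 ^ k ≡ 1` modulo `2 ^ (k + 1)`. -/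
theorem reduceMod_pow_two_pow {x : SpecialLinearGroup (Fin 2) ℤ} (h : reduceMod 2 x = 1) (k : ℕ) :
    reduceMod (2 ^ (k + 1)) (x ^ 2 ^ k) = 1 := by
  induction k with
  | zero => simpa using h
  | succ k ih =>
    rw [reduceMod_eq_one_iff] at ih ⊢
    obtain ⟨Y, hY⟩ := ih
    refine ⟨Y + (2 : ℤ) ^ k • (Y * Y), ?_⟩
    have hsq : (x ^ 2 ^ (k + 1)).1 = (x ^ 2 ^ k).1 * (x ^ 2 ^ k).1 := by
      rw [pow_succ 2 k, pow_mul, pow_two]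
      rfl
    rw [hsq, hY]
    simp only [add_mul, mul_add, one_mul, mul_one, smul_mul_assoc, mul_smul_comm, smul_smul,
      smul_add]
    push_cast
    module

theorem exists_reduceMod_ne_one {x : SpecialLinearGroup (Fin 2) ℤ} (h : x ≠ 1) :
    ∃ m : ℕ, reduceMod (2 ^ (m + 1)) x ≠ 1 := by
  contrapose! h
  ext i j
  change x.1 i j = (1 : Matrix _ _ ℤ) i j
  rw [← sub_eq_zero]
  obtain ⟨z, hz⟩ : ∃ z : ℤ, z = x.1 i j - (1 : Matrix _ _ ℤ) i j := ⟨_, rfl⟩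
  rw [← hz]
  obtain ⟨Y, hY⟩ := reduceMod_eq_one_iff.1 (h z.natAbs)
  refine Int.eq_zero_of_abs_lt_dvd (m := ((2 ^ (z.natAbs + 1) : ℕ) : ℤ)) ⟨Y i j, ?_⟩ ?_
  · rw [hY, Matrix.add_apply, Matrix.smul_apply, add_sub_cancel_left] at hz
    exact hz
  · rw [Int.abs_eq_natAbs]
    exact_mod_cast Nat.lt_two_pow_self.trans (Nat.pow_lt_pow_right one_lt_two (Nat.lt_succ_self _))

/-- Modulo `5` the Sanov matrices generate the perfect group `SL₂(𝔽₅)`. Concretely, the diagonal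
matrix `d = diag(2, 3)` is a product of elementary matrices, and commutators with `d` give back
the elementary matrices. -/
theorem elementary_mem_map_derivedSeries {A : Type*} {a b : A} (hab : b ≠ a) (n : ℕ) :
    (⟨!![1, 1; 0, 1], by decide⟩ : SpecialLinearGroup (Fin 2) (ZMod 5)) ∈
        (derivedSeries (FreeGroup A) n).map ((reduceMod 5).comp (sanov a)) ∧
      (⟨!![1, 0; 1, 1], by decide⟩ : SpecialLinearGroup (Fin 2) (ZMod 5)) ∈
        (derivedSeries (FreeGroup A) n).map ((reduceMod 5).comp (sanov a)) := by
  set U : SpecialLinearGroup (Fin 2) (ZMod 5) := ⟨!![1, 1; 0, 1], by decide⟩ with hU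
  set V : SpecialLinearGroup (Fin 2) (ZMod 5) := ⟨!![1, 0; 1, 1], by decide⟩ with hV
  induction n with
  | zero =>
    constructor
    · refine ⟨FreeGroup.of a ^ 3, by simp, ?_⟩
      have : reduceMod 5 sanovUpper ^ 3 = U := Subtype.ext (by decide +kernel)
      simpa [sanov] using this
    · refine ⟨FreeGroup.of b ^ 3, by simp, ?_⟩
      have : reduceMod 5 sanovLower ^ 3 = V := Subtype.ext (by decide +kernel)
      simpa [sanov, hab] using this
  | succ n ih =>
    obtain ⟨hU', hV'⟩ := ih
    rw [derivedSeries_succ, Subgroup.map_commutator]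
    set S := (derivedSeries (FreeGroup A) n).map ((reduceMod 5).comp (sanov a))
    have hd : U ^ 2 * V ^ 2 * U * V * U ^ 4 ∈ S :=
      S.mul_mem (S.mul_mem (S.mul_mem (S.mul_mem (S.pow_mem hU' 2) (S.pow_mem hV' 2)) hU') hV')
        (S.pow_mem hU' 4)
    have h1 : ⁅U ^ 2 * V ^ 2 * U * V * U ^ 4, U⁆ ^ 2 = U := Subtype.ext (by decide +kernel)
    have h2 : ⁅U ^ 2 * V ^ 2 * U * V * U ^ 4, V⁆ ^ 2 = V := Subtype.ext (by decide +kernel)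
    constructor
    · rw [← h1]
      exact Subgroup.pow_mem _ (Subgroup.commutator_mem_commutator hd hU') 2
    · rw [← h2]
      exact Subgroup.pow_mem _ (Subgroup.commutator_mem_commutator hd hV') 2

theorem exists_mem_derivedSeries_sanov_ne_one {A : Type*} {a b : A} (hab : b ≠ a) (n : ℕ) :
    ∃ x ∈ derivedSeries (FreeGroup A) n, sanov a x ≠ 1 := by
  obtain ⟨x, hx, hxU⟩ := (elementary_mem_map_derivedSeries hab n).1
  refine ⟨x, hx, fun h => ?_⟩
  rw [MonoidHom.comp_apply, h, map_one] at hxU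
  exact absurd (congrArg (fun y : SpecialLinearGroup (Fin 2) (ZMod 5) => y.1 0 1) hxU) (by decide)

/-- The terms of the derived series of a nonabelian free group have nontrivial images in finite
`2`-groups, which are quotients of the free group: reduce the Sanov subgroup of `SL₂(ℤ)` modulo
a large power of `2`. -/
theorem exists_isPGroup_two_derivedSeries_ne_bot {A : Type*} {a b : A} (hab : b ≠ a) (n : ℕ) :
    ∃ (Q : Type) (_ : Group Q) (f : FreeGroup A →* Q), Finite Q ∧ IsPGroup 2 Q ∧
      Function.Surjective f ∧ derivedSeries Q n ≠ ⊥ := by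
  obtain ⟨x, hx, hx1⟩ := exists_mem_derivedSeries_sanov_ne_one hab n
  obtain ⟨m, hm⟩ := exists_reduceMod_ne_one hx1
  let f := (reduceMod (2 ^ (m + 1))).comp (sanov a)
  have : Finite (SpecialLinearGroup (Fin 2) (ZMod (2 ^ (m + 1)))) := Subtype.finite
  refine ⟨f.range, inferInstance, f.rangeRestrict, inferInstance, ?_,
    f.rangeRestrict_surjective, ?_⟩
  · rintro ⟨_, y, rfl⟩
    refine ⟨m, Subtype.ext ?_⟩
    simpa [f] using reduceMod_pow_two_pow (reduceMod_two_sanov a y) m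
  · intro h
    have := map_derivedSeries_le_derivedSeries f.rangeRestrict n (Subgroup.mem_map_of_mem _ hx)
    rw [h, Subgroup.mem_bot] at this
    exact hm (congrArg Subtype.val this)

end Sanov

theorem derivedLength_le_iff {G : Type*} [Group G] [Group.IsSolvable G] {n : ℕ} :
    derivedLength G ≤ n ↔ derivedSeries G n = ⊥ := by
  refine ⟨fun h => ?_, fun h => Nat.sInf_le h⟩
  have : derivedSeries G (derivedLength G) = ⊥ := Nat.sInf_mem (Group.IsSolvable.solvable (G := G))
  exact le_bot_iff.1 (this ▸ derivedSeries_antitone G h)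

/-- The quotient of a suitable finite `2`-group by the `(n + 1)`-st term of its derived series: the
series of a solvable group is strictly decreasing until it vanishes, so the `n`-th term survives. -/
theorem exists_solvable_quotient {A : Type*} {a b : A} (hab : b ≠ a) (n : ℕ) :
    ∃ (G : Type) (_ : Group G) (f : FreeGroup A →* G), Finite G ∧
      (Group.IsSolvable G ∧ derivedLength G ≤ n + 1) ∧
      ∃ x ∈ derivedSeries (FreeGroup A) n, f x ≠ 1 := by
  obtain ⟨Q, _, f, _, hp, hf, hne⟩ := exists_isPGroup_two_derivedSeries_ne_bot hab n
  have := hp.isNilpotent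
  have hsol : Group.IsSolvable Q := inferInstance
  have hq : Function.Surjective (QuotientGroup.mk' (derivedSeries Q (n + 1))) :=
    QuotientGroup.mk'_surjective _
  refine ⟨Q ⧸ derivedSeries Q (n + 1), inferInstance,
    (QuotientGroup.mk' (derivedSeries Q (n + 1))).comp f, inferInstance,
    ⟨inferInstance, derivedLength_le_iff.2 ?_⟩, ?_⟩
  · rw [← map_derivedSeries_eq hq, Subgroup.map_eq_bot_iff, QuotientGroup.ker_mk']
  · by_contra! h
    refine (Group.IsSolvable.commutator_lt_of_ne_bot hne).not_ge ?_
    rw [← derivedSeries_succ, ← map_derivedSeries_eq hf, Subgroup.map_le_iff_le_comap]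
    intro x hx
    exact (QuotientGroup.eq_one_iff (f x)).1 (h x hx)

/-- The analogue of `exists_solvable_quotient` for the lower central series, which contains the
derived series termwise. -/
theorem exists_nilpotent_quotient {A : Type*} {a b : A} (hab : b ≠ a) (n : ℕ) :
    ∃ (G : Type) (_ : Group G) (f : FreeGroup A →* G), Finite G ∧
      (Group.IsNilpotent G ∧ Group.nilpotencyClass G ≤ n + 1) ∧
      ∃ x ∈ (⊤ : Subgroup (FreeGroup A)).lowerCentralSeries n, f x ≠ 1 := by
  obtain ⟨Q, _, f, _, hp, hf, hne⟩ := exists_isPGroup_two_derivedSeries_ne_bot hab n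
  have := hp.isNilpotent
  let N := (⊤ : Subgroup Q).lowerCentralSeries (n + 1)
  refine ⟨Q ⧸ N, inferInstance, (QuotientGroup.mk' N).comp f, inferInstance,
    ⟨inferInstance, Subgroup.lowerCentralSeries_eq_bot_iff_nilpotencyClass_le.1 ?_⟩, ?_⟩
  · rw [← Subgroup.map_top_of_surjective _ (QuotientGroup.mk'_surjective N),
      ← Subgroup.map_lowerCentralSeries, Subgroup.map_eq_bot_iff, QuotientGroup.ker_mk']
  · by_contra! h
    have hle : (⊤ : Subgroup Q).lowerCentralSeries n ≤ N := by
      rw [← Subgroup.map_top_of_surjective f hf, ← Subgroup.map_lowerCentralSeries,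
        Subgroup.map_le_iff_le_comap]
      exact fun x hx => (QuotientGroup.eq_one_iff (f x)).1 (h x hx)
    -- A repetition makes the series stationary, so its `n`-th term is trivial.
    have hst (k : ℕ) : (⊤ : Subgroup Q).lowerCentralSeries n ≤
        (⊤ : Subgroup Q).lowerCentralSeries (n + k) := by
      induction k with
      | zero => rfl
      | succ k ih => exact hle.trans (Subgroup.commutator_mono ih le_rfl)
    have hbot : (⊤ : Subgroup Q).lowerCentralSeries (n + Group.nilpotencyClass Q) = ⊥ :=
      Subgroup.lowerCentralSeries_eq_bot_iff_nilpotencyClass_le.2 (Nat.le_add_left _ n)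
    exact hne (le_bot_iff.1 ((Subgroup.derived_le_lower_central n).trans (hbot ▸ hst _)))

/-! ### Strictness -/

/-- Words simulate elements of the free group: in a finite group the inverse of a letter is a
power of that letter. -/
theorem exists_word_eq_lift {A : Type*} {P : Type*} [Group P] [Finite P] (η : FreeMonoid A →* P)
    (x : FreeGroup A) :
    ∃ w : FreeMonoid A, η w = FreeGroup.lift (fun a => η (FreeMonoid.of a)) x := by
  induction x using FreeGroup.induction_on with
  | C1 => exact ⟨1, by simp⟩
  | of a => exact ⟨FreeMonoid.of a, by simp⟩
  | inv_of a _ =>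
    refine ⟨FreeMonoid.of a ^ (Nat.card P - 1), ?_⟩
    rw [map_inv, FreeGroup.lift_apply_of, map_pow, eq_inv_iff_mul_eq_one, ← pow_succ,
      Nat.sub_add_cancel Nat.card_pos, pow_card_eq_one']
  | mul x y hx hy =>
    obtain ⟨u, hu⟩ := hx
    obtain ⟨v, hv⟩ := hy
    exact ⟨u * v, by simp [hu, hv]⟩

/-- Let `x` be an element of the free group that is trivial in all the finite groups recognising
the members of `C`, and nontrivial in the finite group `G`. Then the language of the words that
are trivial in `G` separates the two classes: if a member `K` of `C` has a word `w`, it also has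
a word `u * w` with `u` acting as `x`, and at most one of these words is trivial in `G`. -/
theorem RExt_ssubset_of_separating {A : Type*} [Fintype A] [Nonempty A] {C D : Set (Language A)}
    (hCD : C ⊆ D) {G : Type*} [Group G] [Finite G]
    (hG : ∀ L : Language A, Recognises G L → L ∈ D) (f : FreeGroup A →* G) {x : FreeGroup A}
    (hx : f x ≠ 1)
    (hC : ∀ K ∈ C, ∃ (H : Type) (_ : Group H), Finite H ∧ Recognises H K ∧
      ∀ g : FreeGroup A →* H, g x = 1) : RExt C ⊂ RExt D := by
  have := Fintype.ofFinite G
  let η : FreeMonoid A →* G := FreeMonoid.lift fun a => f (FreeGroup.of a)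
  obtain ⟨d, hpos, hd⟩ := exists_hasDensity_kernelLanguage η
  refine (Set.ssubset_iff_of_subset (RExt_mono hCD)).2 ⟨kernelLanguage η,
    ⟨isRegular_kernelLanguage η, measurableBy_of_mem (hG _ (recognises_kernelLanguage η)) hd⟩,
    fun h => not_measurableBy_of_pos hd hpos ?_ h.2⟩
  intro K hK hKL w hw
  obtain ⟨H, _, _, ⟨φ, S, hφ⟩, hH⟩ := hC K hK
  obtain ⟨u, hu⟩ := exists_word_eq_lift (φ.prod η) x
  have hfst : φ u = 1 := by
    have := congrArg (MonoidHom.fst H G) hu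
    rw [← MonoidHom.comp_apply (MonoidHom.fst H G) (FreeGroup.lift _), hH] at this
    exact this
  have hsnd : η u = f x := by
    have h1 := congrArg (MonoidHom.snd H G) hu
    have h2 : (MonoidHom.snd H G).comp
        (FreeGroup.lift fun a => φ.prod η (FreeMonoid.of a)) = f := by
      ext a; simp [η]
    rw [← MonoidHom.comp_apply (MonoidHom.snd H G) (FreeGroup.lift _), h2] at h1
    exact h1
  have huw : (FreeMonoid.toList u ++ w : List A) ∈ K := by
    rw [hφ, FreeMonoid.ofList_append, FreeMonoid.ofList_toList, map_mul, hfst, one_mul, ← hφ]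
    exact hw
  have h1 := mem_kernelLanguage.1 (hKL _ huw)
  rw [FreeMonoid.ofList_append, FreeMonoid.ofList_toList, map_mul,
    mem_kernelLanguage.1 (hKL _ hw), mul_one, hsnd] at h1
  exact hx h1

theorem GnilLE_subset_GroupLang (A : Type*) (n : ℕ) : GnilLE A n ⊆ GroupLang A :=
  fun _ ⟨G, i, hf, _, hr⟩ => ⟨G, i, hf, hr⟩

theorem GsolLE_subset_GroupLang (A : Type*) (n : ℕ) : GsolLE A n ⊆ GroupLang A :=
  fun _ ⟨G, i, hf, _, hr⟩ => ⟨G, i, hf, hr⟩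

theorem RExt_GnilLE_ssubset {A : Type*} [Fintype A] (hA : 2 ≤ Fintype.card A) (n : ℕ) :
    RExt (GnilLE A n) ⊂ RExt (GnilLE A (n + 1)) := by
  obtain ⟨a, b, hab⟩ := Fintype.exists_pair_of_one_lt_card hA
  have : Nonempty A := ⟨a⟩
  obtain ⟨G, _, f, _, hG, x, hx, hfx⟩ := exists_nilpotent_quotient hab.symm n
  refine RExt_ssubset_of_separating
    (fun _ ⟨G, i, hf, ⟨hn, hc⟩, hr⟩ => ⟨G, i, hf, ⟨hn, hc.trans n.le_succ⟩, hr⟩)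
    (fun L hL => ⟨G, inferInstance, inferInstance, hG, hL⟩) f hfx ?_
  rintro K ⟨H, _, hf, ⟨_, hc⟩, hr⟩
  refine ⟨H, inferInstance, hf, hr, fun g => ?_⟩
  have := Subgroup.mem_map_of_mem g hx
  rw [Subgroup.map_lowerCentralSeries] at this
  have : g x ∈ (⊤ : Subgroup H).lowerCentralSeries n :=
    Subgroup.lowerCentralSeries_mono n le_top this
  rwa [Subgroup.lowerCentralSeries_eq_bot_iff_nilpotencyClass_le.2 hc, Subgroup.mem_bot] at this

theorem RExt_GsolLE_ssubset {A : Type*} [Fintype A] (hA : 2 ≤ Fintype.card A) (n : ℕ) :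
    RExt (GsolLE A n) ⊂ RExt (GsolLE A (n + 1)) := by
  obtain ⟨a, b, hab⟩ := Fintype.exists_pair_of_one_lt_card hA
  have : Nonempty A := ⟨a⟩
  obtain ⟨G, _, f, _, hG, x, hx, hfx⟩ := exists_solvable_quotient hab.symm n
  refine RExt_ssubset_of_separating
    (fun _ ⟨G, i, hf, ⟨hn, hc⟩, hr⟩ => ⟨G, i, hf, ⟨hn, hc.trans n.le_succ⟩, hr⟩)
    (fun L hL => ⟨G, inferInstance, inferInstance, hG, hL⟩) f hfx ?_
  rintro K ⟨H, _, hf, ⟨_, hc⟩, hr⟩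
  refine ⟨H, inferInstance, hf, hr, fun g => ?_⟩
  have := map_derivedSeries_le_derivedSeries g n (Subgroup.mem_map_of_mem g hx)
  rwa [derivedLength_le_iff.1 hc, Subgroup.mem_bot] at this

end LangMeasure

theorem corollary5p2 {A : Type*} [Fintype A] (hA : 2 ≤ Fintype.card A) (n : ℕ) (hn : 1 ≤ n) :
    (LangMeasure.RExt (LangMeasure.GnilLE A n) ⊂ LangMeasure.RExt (LangMeasure.GnilLE A (n + 1)) ∧
      LangMeasure.RExt (LangMeasure.GnilLE A (n + 1)) ⊂
        LangMeasure.RExt (LangMeasure.GroupLang A)) ∧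
    (LangMeasure.RExt (LangMeasure.GsolLE A n) ⊂ LangMeasure.RExt (LangMeasure.GsolLE A (n + 1)) ∧
      LangMeasure.RExt (LangMeasure.GsolLE A (n + 1)) ⊂
        LangMeasure.RExt (LangMeasure.GroupLang A)) :=
  ⟨⟨LangMeasure.RExt_GnilLE_ssubset hA n,
      (LangMeasure.RExt_GnilLE_ssubset hA (n + 1)).trans_subset
        (LangMeasure.RExt_mono (LangMeasure.GnilLE_subset_GroupLang A (n + 2)))⟩,
    ⟨LangMeasure.RExt_GsolLE_ssubset hA n,
      (LangMeasure.RExt_GsolLE_ssubset hA (n + 1)).trans_subset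
        (LangMeasure.RExt_mono (LangMeasure.GsolLE_subset_GroupLang A (n + 2)))⟩⟩
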